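/- A (deterministic) finite automaton with output over base-$b$ digits consists of an integer base $b \ge 2$, a finite set of states with an initial state, a transition function $\delta : Q \times \{0,\dots,b-1\} \to Q$, and an output function $Q \to \Sigma$ into a finite alphabet $\Sigma$. It computes the sequence $w \in \Sigma^{\mathbb N}$ whose $i$-th letter $w(i)$ is the output at the state reached from the initial state after reading the base-$b$ expansion of $i$ (without leading zeros; the expansion of $0$ is the empty word). A sequence $w \in \Sigma^{\mathbb N}$ is automatic if it is computed in this way by some such automaton. An infix of $w$ is a finite word $w(i)w(i+1)\cdots w(i+\ell-1)$ with $i,\ell \ge 0$. For finite words $u, v$, write $u \sqsubseteq_{\mathrm{infix}} v$ if there are finite words $x,y$ with $v = xuy$. A set $L$ of finite words is well-quasi-ordered by the infix relation if for every infinite sequence $u_0,u_1,\dots$ of elements of $L$ there are $i<j$ with $u_i \sqsubseteq_{\mathrm{infix}} u_j$. **Theorem.** Given an automatic sequence $w \in \Sigma^{\mathbb N}$, it is decidable whether the set of infixes of $w$ is well-quasi-ordered by the infix relation. That is, for each of the two digit orders (most significant digit first, least significant digit first) there is an algorithm (a total computable function) which, given as input the finite table describing an arbitrary automaton as above (base,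 alphabet, states, initial state, transitions and outputs all being part of the input, with $Q$ and $\Sigma$ numbered as initial segments of $\mathbb N$), outputs $1$ if the set of infixes of the sequence computed by that automaton in the given digit order is well-quasi-ordered by the infix relation, and $0$ otherwise. -/

import Mathlib

/-- The order in which an automaton reads the base-`b` digits of a number. -/
inductive DigitOrder
  | msdFirst
  | lsdFirst

/-- A finite automaton with output, over the input alphabet `{0, …, base - 1}` of base-`base`
digits, with states `{0, …, numStates - 1}` and output alphabet `{0, …, numLetters - 1}`. -/
structure DigitAutomaton where
  base : ℕ
  two_le_base : 2 ≤ base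
  numStates : ℕ
  numLetters : ℕ
  step : Fin numStates → Fin base → Fin numStates
  start : Fin numStates
  out : Fin numStates → Fin numLetters

namespace DigitAutomaton

/-- The letter that is output after reading a word of digits from left to right. -/
def output (M : DigitAutomaton) (x : List (Fin M.base)) : Fin M.numLetters :=
  M.out (x.foldl M.step M.start)

/-- The base-`M.base` expansion of `i` without superfluous zeros, least significant digit first;
it is the empty word for `i = 0`. -/
def digits (M : DigitAutomaton) (i : ℕ) : List (Fin M.base) :=
  (Nat.digits M.base i).pmap Fin.mk (fun _ h => Nat.digits_lt_base M.two_le_base h)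

/-- The word of digits of `i` in the given reading order. -/
def inputWord (M : DigitAutomaton) : DigitOrder → ℕ → List (Fin M.base)
  | .msdFirst, i => (M.digits i).reverse
  | .lsdFirst, i => M.digits i

/-- The automatic sequence computed by `M`: its `i`-th letter is the output of `M` on `i`. -/
def sequence (M : DigitAutomaton) (o : DigitOrder) (i : ℕ) : Fin M.numLetters :=
  M.output (M.inputWord o i)

/-- The finite description of `M`: base, alphabet size, initial state, and for each state (in
order) its output letter and the list of its successors for the digits `0, …, base - 1`. -/
def code (M : DigitAutomaton) : ℕ × ℕ × ℕ × List (ℕ × List ℕ) :=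
  (M.base, M.numLetters, (M.start : ℕ),
    List.ofFn fun q => ((M.out q : ℕ), List.ofFn fun d => (M.step q d : ℕ)))

end DigitAutomaton

/-- The set of (finite, possibly empty) infixes of an infinite word. -/
def infixSet {α : Type*} (w : ℕ → α) : Set (List α) :=
  {u | ∃ i l : ℕ, u = List.ofFn fun j : Fin l => w (i + j)}

/-! Over a finite alphabet, the infixes are well-quasi-ordered iff the sequence is ultimately
uniformly recurrent (`infixSet_partiallyWellOrderedOn_iff_recurrent`). The latter is a first-order
statement about addition, order and equality of letters, so Büchi's argument applies: each formula
defines a relation recognized by a finite automaton on parallel digits. No automaton is constructed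
by the algorithm. Only a bound on the number of states is needed: by pumping
(`IsRecognizable.exists_small`), a satisfiable existential has a witness with at most that many
digits more than the parameters. Every quantifier thus becomes bounded, and brute-force evaluation
(`HoldsBounded`) is primitive recursive in the table of the automaton. -/

/-- The factor of length `l` of `w` that starts at position `i`. -/
def factor {α : Type*} (w : ℕ → α) (i l : ℕ) : List α := List.ofFn fun j : Fin l => w (i + j)

/-- Some suffix of `w` is uniformly recurrent: each of its factors occurs in it with bounded
gaps. -/
def UltimatelyUniformlyRecurrent {α : Type*} (w : ℕ → α) : Prop :=
  ∃ N, ∀ i, N ≤ i → ∀ n, ∃ K, ∀ j, N ≤ j → ∃ y, j ≤ y ∧ y ≤ j + K ∧ ∀ t < n, w (i + t) = w (y + t)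

/-! ### Well-quasi-ordered infixes and uniform recurrence -/

section Recurrence

variable {α : Type*} {w : ℕ → α}

theorem length_factor (i l : ℕ) : (factor w i l).length = l := by simp [factor]

theorem factor_getElem? (i l k : ℕ) (h : k < l) : (factor w i l)[k]? = some (w (i + k)) := by
  simp [factor, h]

theorem factor_infix_iff {i l i' l' : ℕ} :
    factor w i l <:+: factor w i' l' ↔
      ∃ k, k + l ≤ l' ∧ ∀ t < l, w (i + t) = w (i' + k + t) := by
  rw [List.infix_iff_getElem?]
  simp only [length_factor]
  refine exists_congr fun k => ?_
  constructor
  · rintro ⟨h1, h2⟩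
    refine ⟨by omega, fun t ht => ?_⟩
    have h := h2 t ht
    rw [factor_getElem? _ _ _ (by omega)] at h
    simp only [factor, List.getElem_ofFn, Option.some.injEq] at h
    rw [← h, add_assoc, add_comm k t]
  · rintro ⟨h1, h2⟩
    refine ⟨by omega, fun t ht => ?_⟩
    rw [factor_getElem? _ _ _ (by omega)]
    simp only [factor, List.getElem_ofFn, h2 t ht, Option.some.injEq]
    congr 1; omega

theorem infixSet_partiallyWellOrderedOn_iff :
    (infixSet w).PartiallyWellOrderedOn (fun u v => u <:+: v) ↔
      ∀ i l : ℕ → ℕ, ∃ m n, m < n ∧ factor w (i m) (l m) <:+: factor w (i n) (l n) := by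
  rw [Set.partiallyWellOrderedOn_iff_exists_lt]
  constructor
  · intro h i l
    exact h (fun n => factor w (i n) (l n)) fun n => ⟨i n, l n, rfl⟩
  · intro h f hf
    choose i l hil using hf
    obtain ⟨m, n, hmn, hi⟩ := h i l
    exact ⟨m, n, hmn, by rw [hil m, hil n]; exact hi⟩

/-- Serves to thin a family of counterexamples so that each later member lies beyond the threshold
`p` of every earlier one. -/
theorem exists_seq_forall_lt (p : ℕ → ℕ) :
    ∃ a : ℕ → ℕ, ∀ k l, k < l → p (a k) ≤ a l := by
  let a : ℕ → ℕ := fun k => Nat.rec 0 (fun _ r => max r (p r)) k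
  have hs : ∀ k, a (k + 1) = max (a k) (p (a k)) := fun k => rfl
  have hm : Monotone a := monotone_nat_of_le_succ fun k => by rw [hs]; exact le_max_left _ _
  refine ⟨a, fun k l h => ?_⟩
  exact ((hs k).symm ▸ le_max_right _ _ : p (a k) ≤ a (k + 1)).trans (hm h)

/-- Well-quasi-ordering by infixes forces every factor of some suffix to occur infinitely often. -/
theorem exists_recurrent_suffix
    (h : ∀ i l : ℕ → ℕ, ∃ m n, m < n ∧ factor w (i m) (l m) <:+: factor w (i n) (l n)) :
    ∃ N, ∀ i, N ≤ i → ∀ n M, ∃ y, M ≤ y ∧ ∀ t < n, w (i + t) = w (y + t) := by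
  by_contra hc
  push Not at hc
  choose i hi n M hM using hc
  obtain ⟨a, ha⟩ := exists_seq_forall_lt M
  obtain ⟨k, l, hkl, hf⟩ := h (fun k => i (a k)) (fun k => n (a k))
  obtain ⟨o, -, ho⟩ := factor_infix_iff.1 hf
  obtain ⟨t, ht, hne⟩ := hM (a k) (i (a l) + o) (by have := ha k l hkl; have := hi (a l); omega)
  exact hne (ho t ht)

/-- An occurrence-free stretch between occurrences extends to a gap between consecutive ones. -/
theorem exists_consecutive {P : ℕ → Prop} {i K j : ℕ} (hi : P i) (hij : i < j)
    (hj : ∀ y, j ≤ y → y ≤ j + K → ¬ P y) (hinf : ∃ y, j ≤ y ∧ P y) :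
    ∃ a g, K < g ∧ P a ∧ P (a + g) ∧ ∀ y, a < y → y < a + g → ¬ P y := by
  classical
  let z := Nat.find hinf
  obtain ⟨hz1, hz2⟩ : j ≤ z ∧ P z := Nat.find_spec hinf
  have hz3 : ∀ y, j ≤ y → P y → z ≤ y := fun y h1 h2 => Nat.find_min' hinf ⟨h1, h2⟩
  let a := Nat.findGreatest P (j - 1)
  have ha1 : P a := Nat.findGreatest_spec (m := i) (by omega) hi
  have ha2 : a ≤ j - 1 := Nat.findGreatest_le _
  have ha3 : ∀ y, a < y → y ≤ j - 1 → ¬ P y := fun y h1 h2 => Nat.findGreatest_is_greatest h1 h2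
  have hz4 : j + K < z := by
    by_contra hlt
    exact hj z hz1 (by omega) hz2
  refine ⟨a, z - a, by omega, ha1, by rwa [show a + (z - a) = z by omega], fun y h1 h2 hy => ?_⟩
  by_cases hyj : y ≤ j - 1
  · exact ha3 y h1 hyj hy
  · have := hz3 y (by omega) hy
    omega

/-- If the gaps between consecutive occurrences of some factor are unbounded, take the stretches
from one occurrence through the next, with gaps strictly increasing. An earlier stretch inside a
later one would put an occurrence strictly inside the gap. -/
theorem UltimatelyUniformlyRecurrent.of_infix
    (h : ∀ i l : ℕ → ℕ, ∃ m n, m < n ∧ factor w (i m) (l m) <:+: factor w (i n) (l n)) :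
    UltimatelyUniformlyRecurrent w := by
  obtain ⟨N, hN⟩ := exists_recurrent_suffix h
  by_contra hc
  simp only [UltimatelyUniformlyRecurrent] at hc
  push Not at hc
  obtain ⟨i, hi, n, hK⟩ := hc N
  let P : ℕ → Prop := fun y => ∀ t < n, w (i + t) = w (y + t)
  have hgap : ∀ K, ∃ a g, K < g ∧ P a ∧ P (a + g) ∧ ∀ y, a < y → y < a + g → ¬ P y := by
    intro K
    -- The extra `i` in the window length forces `i < j`: otherwise `i` itself would be an
    -- occurrence in the window.
    obtain ⟨j, hj, hno⟩ := hK (i + K)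
    have hno' : ∀ y, j ≤ y → y ≤ j + (i + K) → ¬ P y := by
      intro y h1 h2 h3
      obtain ⟨t, ht, hne⟩ := hno y h1 h2
      exact hne (h3 t ht)
    have hij : i < j := by
      by_contra hlt
      exact hno' i (by omega) (by omega) fun t _ => rfl
    obtain ⟨a, g, hg, hr⟩ := exists_consecutive (P := P) (fun t _ => rfl) hij hno' (hN i hi n j)
    exact ⟨a, g, by omega, hr⟩
  choose a g hg hPa hPg hbetween using hgap
  obtain ⟨s, hs⟩ := exists_seq_forall_lt g
  obtain ⟨k, l, hkl, hf⟩ := h (fun k => a (s k)) (fun k => g (s k) + n)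
  obtain ⟨o, hol, ho⟩ := factor_infix_iff.1 hf
  have h1 : P (a (s l) + o) := fun t ht => (hPa (s k) t ht).trans (ho t (by omega))
  have h2 : P (a (s l) + o + g (s k)) := fun t ht => by
    have := ho (g (s k) + t) (by omega)
    rw [hPg (s k) t ht, add_assoc, this, ← add_assoc]
  have hlt : g (s k) < g (s l) := (hs k l hkl).trans_lt (hg (s l))
  have hpos : 0 < g (s k) := (Nat.zero_le _).trans_lt (hg (s k))
  by_cases ho0 : o = 0
  · subst ho0
    exact hbetween (s l) _ (by omega) (by omega) h2
  · exact hbetween (s l) _ (by omega) (by omega) h1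

/-- A bad sequence has distinct terms, so over a finite alphabet its lengths are unbounded. A term
starting in the recurrent part occurs in every sufficiently long factor. If no term starts there,
infinitely many share a starting position, and a shorter one is a prefix of a longer one. -/
theorem UltimatelyUniformlyRecurrent.infix [Finite α] (h : UltimatelyUniformlyRecurrent w)
    (i l : ℕ → ℕ) : ∃ m n, m < n ∧ factor w (i m) (l m) <:+: factor w (i n) (l n) := by
  by_contra hc
  push Not at hc
  have hinj : Function.Injective fun k => factor w (i k) (l k) := by
    intro a b hab
    have hab' : factor w (i a) (l a) = factor w (i b) (l b) := hab
    rcases lt_trichotomy a b with hlt | rfl | hlt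
    · exact (hc a b hlt (hab' ▸ List.infix_rfl)).elim
    · rfl
    · exact (hc b a hlt (hab' ▸ List.infix_rfl)).elim
  have hfin : ∀ L, {k | l k ≤ L}.Finite := fun L =>
    ((List.finite_length_le α L).preimage hinj.injOn).subset fun k hk => by
      simpa [length_factor] using hk
  have hlarge : ∀ S : Set ℕ, S.Infinite → ∀ k L, ∃ k' ∈ S, k < k' ∧ L < l k' := by
    intro S hS k L
    obtain ⟨k', hk', hn⟩ := hS.exists_notMem_finite ((Set.finite_Iic k).union (hfin L))
    simp only [Set.mem_union, Set.mem_Iic, Set.mem_ofPred_eq] at hn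
    exact ⟨k', hk', by omega, by omega⟩
  obtain ⟨N, hN⟩ := h
  by_cases hex : ∃ k, N ≤ i k
  · obtain ⟨k, hk⟩ := hex
    obtain ⟨K, hK⟩ := hN (i k) hk (l k)
    obtain ⟨k', -, hlt, hl⟩ := hlarge Set.univ Set.infinite_univ k (N + K + l k)
    -- The shift by `N` moves the search into the recurrent part, and the length of the `k'`-th
    -- factor leaves room for it.
    obtain ⟨y, hy1, hy2, hy3⟩ := hK (i k' + N) (by omega)
    refine hc k k' hlt (factor_infix_iff.2 ⟨y - i k', by omega, fun t ht => ?_⟩)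
    rw [hy3 t ht]
    congr 1; omega
  · push Not at hex
    obtain ⟨q, hq⟩ := Finite.exists_infinite_fiber fun k => (⟨i k, hex k⟩ : Fin N)
    rw [Set.infinite_coe_iff] at hq
    obtain ⟨k, hk⟩ := hq.nonempty
    obtain ⟨k', hk', hlt, hl⟩ := hlarge _ hq k (l k)
    have hkk : i k = i k' := by
      have : (⟨i k, hex k⟩ : Fin N) = ⟨i k', hex k'⟩ := Eq.trans hk (Eq.symm hk')
      simpa using this
    exact hc k k' hlt (factor_infix_iff.2 ⟨0, by omega, fun t _ => by rw [hkk, add_zero]⟩)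

/-- The infixes of a sequence over a finite alphabet are well-quasi-ordered if and only if the
sequence is ultimately uniformly recurrent. -/
theorem infixSet_partiallyWellOrderedOn_iff_recurrent [Finite α] :
    (infixSet w).PartiallyWellOrderedOn (fun u v => u <:+: v) ↔
      UltimatelyUniformlyRecurrent w :=
  infixSet_partiallyWellOrderedOn_iff.trans
    ⟨UltimatelyUniformlyRecurrent.of_infix, UltimatelyUniformlyRecurrent.infix⟩

end Recurrence

/-! ### Relations recognized by finite automata, and pumping -/

/-- The values `w i` are determined by the states, at most `c` in number, that a deterministic
automaton reaches after reading the base-`b` digits of `i`, most significant digit first. -/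
def HasStateBound {α : Type*} (b c : ℕ) (w : ℕ → α) : Prop :=
  ∃ (Q : Type) (_ : Fintype Q) (s : ℕ → Q), Fintype.card Q ≤ c ∧
    (∀ u u' d, d < b → s u = s u' → s (b * u + d) = s (b * u' + d)) ∧
    ∀ u u', s u = s u' → w u = w u'

/-- A relation on valuations is decided by a deterministic automaton with at most `c` states that
reads the base-`b` digits of all variables in parallel, most significant digits first. -/
def IsRecognizable (b c : ℕ) (R : (ℕ → ℕ) → Prop) : Prop :=
  ∃ (Q : Type) (_ : Fintype Q) (s : (ℕ → ℕ) → Q), Fintype.card Q ≤ c ∧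
    (∀ u u' d : ℕ → ℕ, (∀ i, d i < b) → s u = s u' →
      s (fun i => b * u i + d i) = s (fun i => b * u' i + d i)) ∧
    ∀ u u', s u = s u' → (R u ↔ R u')

/-- The valuation that gives the value `y` to the variable `0` and shifts the others. -/
def consVal (y : ℕ) (v : ℕ → ℕ) : ℕ → ℕ
  | 0 => y
  | k + 1 => v k

theorem consVal_digit (b y e : ℕ) (v d : ℕ → ℕ) :
    consVal (b * y + e) (fun i => b * v i + d i) =
      fun i => b * consVal y v i + consVal e d i := by
  funext i; cases i <;> rfl

theorem consVal_lt {b e : ℕ} {d : ℕ → ℕ} (he : e < b) (hd : ∀ i, d i < b) (i : ℕ) :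
    consVal e d i < b := by
  cases i
  · exact he
  · exact hd _

section Recognizable

variable {b : ℕ}

theorem congr_append_digits {Q : Type} {s : (ℕ → ℕ) → Q}
    (hs : ∀ u u' d : ℕ → ℕ, (∀ i, d i < b) → s u = s u' →
      s (fun i => b * u i + d i) = s (fun i => b * u' i + d i))
    (hb : 0 < b) {u u' : ℕ → ℕ} (h : s u = s u') (m : ℕ) :
    ∀ r : ℕ → ℕ, (∀ i, r i < b ^ m) →
      s (fun i => b ^ m * u i + r i) = s (fun i => b ^ m * u' i + r i) := by
  induction m with
  | zero =>
    intro r hr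
    have : ∀ i, r i = 0 := fun i => by simpa using hr i
    simpa [this] using h
  | succ m ih =>
    intro r hr
    have h1 := ih (fun i => r i / b) fun i => by
      rw [Nat.div_lt_iff_lt_mul hb]
      exact (hr i).trans_eq (pow_succ b m)
    have h2 := hs _ _ (fun i => r i % b) (fun i => Nat.mod_lt _ hb) h1
    have key : ∀ x : ℕ → ℕ, (fun i => b * (b ^ m * x i + r i / b) + r i % b) =
        fun i => b ^ (m + 1) * x i + r i := by
      intro x
      funext i
      conv_rhs => rw [← Nat.div_add_mod (r i) b]
      ring
    rwa [key, key] at h2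

/-- A satisfiable instance of a recognizable relation has a solution whose digit length exceeds
that of the parameters by at most the number of states. -/
theorem IsRecognizable.exists_small {c : ℕ} {R : (ℕ → ℕ) → Prop} (hR : IsRecognizable b c R)
    (hb : 2 ≤ b) {L : ℕ} {v : ℕ → ℕ} (hv : ∀ i, v i < b ^ L) (h : ∃ y, R (consVal y v)) :
    ∃ y < b ^ (L + c), R (consVal y v) := by
  classical
  obtain ⟨Q, _, s, hc, hs, hR⟩ := hR
  let y := Nat.find h
  have hy : R (consVal y v) := Nat.find_spec h
  refine ⟨y, ?_, hy⟩
  by_contra hlt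
  push Not at hlt
  -- Above position `L` the parameters have only zero digits, so the states there depend on the
  -- leading part of `y` alone. A repeated state allows a block of digits to be cut out,
  -- contradicting the minimality of `y`.
  let f : Fin (c + 1) → Q := fun m => s (consVal (y / b ^ (L + m)) 0)
  obtain ⟨m, m', hmm, hf⟩ : ∃ m m' : Fin (c + 1), m < m' ∧ f m = f m' := by
    obtain ⟨m, m', hne, hf⟩ := Fintype.exists_ne_map_eq_of_card_lt f (by simp; omega)
    rcases lt_or_gt_of_ne hne with h | h
    · exact ⟨m, m', h, hf⟩
    · exact ⟨m', m, h, hf.symm⟩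
  have hb0 : 0 < b := by omega
  have hpow : ∀ k, 0 < b ^ k := fun k => pow_pos hb0 k
  let r : ℕ → ℕ := consVal (y % b ^ (L + m)) v
  have hr : ∀ i, r i < b ^ (L + m) := by
    refine consVal_lt (Nat.mod_lt _ (hpow _)) fun i => (hv i).trans_le ?_
    exact Nat.pow_le_pow_right hb0 (by omega)
  have h1 := congr_append_digits hs hb0 hf (L + m) r hr
  have key : ∀ x, (fun i => b ^ (L + m) * consVal x 0 i + r i) =
      consVal (b ^ (L + m) * x + y % b ^ (L + m)) v := by
    intro x
    funext i
    cases i <;> simp [r, consVal]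
  rw [key, key, Nat.div_add_mod] at h1
  have hlt' : y / b ^ (L + m') < y / b ^ (L + m) := by
    have h2 : 1 ≤ y / b ^ (L + m) := by
      rw [Nat.le_div_iff_mul_le (hpow _), one_mul]
      exact (Nat.pow_le_pow_right hb0 (by have := m.2; omega)).trans hlt
    obtain ⟨k, hk⟩ : ∃ k, (L + m' : ℕ) = L + m + (k + 1) :=
      ⟨m' - m - 1, by have : (m : ℕ) < m' := hmm; omega⟩
    rw [hk, pow_add, ← Nat.div_div_eq_div_mul]
    exact Nat.div_lt_self h2 (Nat.one_lt_pow (by omega) (by omega))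
  have hmin := Nat.find_min' h ((hR _ _ h1).1 hy)
  have : b ^ (L + m) * (y / b ^ (L + m')) + y % b ^ (L + m) < y := by
    conv_rhs => rw [← Nat.div_add_mod y (b ^ (L + m))]
    have := Nat.mul_lt_mul_of_pos_left hlt' (hpow (L + m))
    omega
  exact absurd hmin (by omega)

theorem IsRecognizable.not {c : ℕ} {R : (ℕ → ℕ) → Prop} (h : IsRecognizable b c R) :
    IsRecognizable b c fun v => ¬ R v := by
  obtain ⟨Q, hQ, s, hc, hs, hR⟩ := h
  exact ⟨Q, hQ, s, hc, hs, fun u u' hu => not_congr (hR u u' hu)⟩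

theorem IsRecognizable.and {c c' : ℕ} {R R' : (ℕ → ℕ) → Prop} (h : IsRecognizable b c R)
    (h' : IsRecognizable b c' R') : IsRecognizable b (c * c') fun v => R v ∧ R' v := by
  obtain ⟨Q, _, s, hc, hs, hR⟩ := h
  obtain ⟨Q', _, s', hc', hs', hR'⟩ := h'
  refine ⟨Q × Q', inferInstance, fun v => (s v, s' v), ?_, fun u u' d hd hu => ?_,
    fun u u' hu => ?_⟩
  · rw [Fintype.card_prod]; exact Nat.mul_le_mul hc hc'
  · rw [Prod.mk.injEq] at hu ⊢
    exact ⟨hs u u' d hd hu.1, hs' u u' d hd hu.2⟩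
  · rw [Prod.mk.injEq] at hu
    exact and_congr (hR u u' hu.1) (hR' u u' hu.2)

/-- Subset construction. Leading zeros need no care, since states are attached to values rather than
to digit words. -/
theorem IsRecognizable.exists {c : ℕ} {R : (ℕ → ℕ) → Prop} (hb : 0 < b)
    (h : IsRecognizable b c R) : IsRecognizable b (2 ^ c) fun v => ∃ y, R (consVal y v) := by
  classical
  obtain ⟨Q, _, s, hc, hs, hR⟩ := h
  refine ⟨Set Q, inferInstance, fun v => Set.range fun y => s (consVal y v), ?_, ?_, ?_⟩
  · rw [Fintype.card_set]; exact Nat.pow_le_pow_right two_pos hc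
  · have key : ∀ u u' d : ℕ → ℕ, (∀ i, d i < b) →
        (Set.range fun y => s (consVal y u)) = (Set.range fun y => s (consVal y u')) →
        (Set.range fun y => s (consVal y fun i => b * u i + d i)) ⊆
          Set.range fun y => s (consVal y fun i => b * u' i + d i) := by
      rintro u u' d hd hu _ ⟨y, rfl⟩
      obtain ⟨y', hy'⟩ : s (consVal (y / b) u) ∈ Set.range fun y => s (consVal y u') :=
        hu ▸ Set.mem_range_self _
      have h1 := hs _ _ _ (consVal_lt (Nat.mod_lt y hb) hd) hy'
      rw [← consVal_digit, ← consVal_digit, Nat.div_add_mod] at h1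
      exact ⟨_, h1⟩
    exact fun u u' d hd hu => (key u u' d hd hu).antisymm (key u' u d hd hu.symm)
  · have key : ∀ u u' : ℕ → ℕ,
        (Set.range fun y => s (consVal y u)) = (Set.range fun y => s (consVal y u')) →
        (∃ y, R (consVal y u)) → ∃ y, R (consVal y u') := by
      rintro u u' hu ⟨y, hy⟩
      obtain ⟨y', hy'⟩ : s (consVal y u) ∈ Set.range fun y => s (consVal y u') :=
        hu ▸ Set.mem_range_self _
      exact ⟨y', (hR _ _ hy').2 hy⟩
    exact fun u u' hu => ⟨key u u' hu, key u' u hu.symm⟩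

/-- The difference `n - m` up to truncation to `{-1, 0, 1, 2}`, shifted by `1`. -/
def truncDiff (m n : ℕ) : Fin 4 :=
  if n < m then 0 else if n = m then 1 else if n = m + 1 then 2 else 3

/-- Appending digits turns the difference `D = v i - (v j + v k)` into `b * D + r` with `-(2 * b -
2) ≤ r ≤ b - 1`. So `D < 0` stays negative and `D ≥ 2` stays at least `2`, and the truncated
difference suffices. -/
theorem isRecognizable_le (i j k : ℕ) : IsRecognizable b 4 fun v => v i ≤ v j + v k := by
  refine ⟨Fin 4, inferInstance, fun v => truncDiff (v j + v k) (v i), by simp, ?_, ?_⟩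
  · intro u u' d hd hu
    have key : ∀ x y z p q r : ℕ, p < b → q < b → r < b →
        truncDiff (b * x + p + (b * y + q)) (b * z + r) =
          if z < x + y then 0
          else if z = x + y then truncDiff (p + q) r
          else if z = x + y + 1 then truncDiff (p + q) (b + r) else 3 := by
      intro x y z p q r hp hq hr
      have e : b * x + p + (b * y + q) = b * (x + y) + (p + q) := by ring
      rw [e]
      generalize x + y = t
      rcases lt_trichotomy z t with h | rfl | h
      · have := Nat.mul_le_mul_left b h
        rw [Nat.mul_succ] at this
        rw [if_pos h, truncDiff, if_pos (by omega)]
      · rw [if_neg (lt_irrefl _), if_pos rfl]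
        simp only [truncDiff]
        congr 1 <;> grind
      · rw [if_neg (by omega), if_neg (by omega)]
        by_cases h' : z = t + 1
        · subst h'
          rw [if_pos rfl, Nat.mul_succ]
          simp only [truncDiff]
          congr 1 <;> grind
        · have := Nat.mul_le_mul_left b (show t + 2 ≤ z by omega)
          rw [Nat.mul_add] at this
          rw [if_neg h', truncDiff, if_neg (by omega), if_neg (by omega), if_neg (by omega)]
    simp only [key _ _ _ _ _ _ (hd j) (hd k) (hd i)]
    simp only [truncDiff] at hu ⊢
    split_ifs at hu <;> first | (simp at hu; done) | (split_ifs <;> rfl)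
  · intro u u' hu
    simp only [truncDiff] at hu
    split_ifs at hu <;> first | (simp at hu; done) | omega

/-- The carry into a sum of two numbers is `0` or `1`, so it suffices to track the states of each
sum and of its successor. -/
theorem isRecognizable_same {α : Type*} {c : ℕ} {w : ℕ → α} (hw : HasStateBound b c w)
    (i j k : ℕ) : IsRecognizable b (c ^ 4) fun v => w (v i + v k) = w (v j + v k) := by
  obtain ⟨Q, _, s, hc, hs, hw⟩ := hw
  refine ⟨Q × Q × Q × Q, inferInstance, fun v => (s (v i + v k), s (v i + v k + 1),
    s (v j + v k), s (v j + v k + 1)), ?_, ?_, ?_⟩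
  · calc _ ≤ c * (c * (c * c)) := by
          simp only [Fintype.card_prod]; gcongr
      _ = c ^ 4 := by ring
  · have key : ∀ x x' e : ℕ, e < 2 * b → s x = s x' → s (x + 1) = s (x' + 1) →
        s (b * x + e) = s (b * x' + e) := by
      intro x x' e he h h'
      by_cases heb : e < b
      · exact hs _ _ _ heb h
      · have := hs _ _ (e - b) (by omega) h'
        rwa [Nat.mul_succ, Nat.mul_succ, show b * x + b + (e - b) = b * x + e by omega,
          show b * x' + b + (e - b) = b * x' + e by omega] at this
    intro u u' d hd hu
    simp only [Prod.mk.injEq] at hu ⊢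
    obtain ⟨h1, h2, h3, h4⟩ := hu
    have hi := hd i
    have hj := hd j
    have hk := hd k
    have e : ∀ x y p q : ℕ, b * x + p + (b * y + q) = b * (x + y) + (p + q) := by
      intros; ring
    simp only [e, add_assoc (b * _)]
    exact ⟨key _ _ _ (by omega) h1 h2, key _ _ _ (by omega) h1 h2,
      key _ _ _ (by omega) h3 h4, key _ _ _ (by omega) h3 h4⟩
  · intro u u' hu
    simp only [Prod.mk.injEq] at hu
    rw [iff_iff_eq]
    exact congrArg₂ _ (hw _ _ hu.1) (hw _ _ hu.2.2.1)

end Recognizable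

/-! ### First-order formulas and bounded quantification -/

/-- First-order formulas, with de Bruijn indices, over the natural numbers with a sequence. -/
inductive SeqFormula
  | le (i j k : ℕ)
  | same (i j k : ℕ)
  | not (φ : SeqFormula)
  | and (φ ψ : SeqFormula)
  | ex (φ : SeqFormula)

namespace SeqFormula

/-- The truth of a formula about the sequence `w` under a valuation. -/
def Holds {α : Type*} (w : ℕ → α) : SeqFormula → (ℕ → ℕ) → Prop
  | le i j k, v => v i ≤ v j + v k
  | same i j k, v => w (v i + v k) = w (v j + v k)
  | not φ, v => ¬ φ.Holds w v
  | and φ ψ, v => φ.Holds w v ∧ ψ.Holds w v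
  | ex φ, v => ∃ y, φ.Holds w (consVal y v)

/-- A bound on the number of states needed to recognize a formula about a sequence that is
generated by `c` states. -/
def numStates (c : ℕ) : SeqFormula → ℕ
  | le _ _ _ => 4
  | same _ _ _ => c ^ 4
  | not φ => φ.numStates c
  | and φ ψ => φ.numStates c * ψ.numStates c
  | ex φ => 2 ^ φ.numStates c

/-- The truth of a formula with quantifiers restricted to numbers of bounded digit length, where
`L` is a bound on the digit length of the current values. -/
def HoldsBounded {α : Type*} (w : ℕ → α) (b c : ℕ) : SeqFormula → ℕ → List ℕ → Prop
  | le i j k, _, l => l.getD i 0 ≤ l.getD j 0 + l.getD k 0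
  | same i j k, _, l => w (l.getD i 0 + l.getD k 0) = w (l.getD j 0 + l.getD k 0)
  | not φ, L, l => ¬ φ.HoldsBounded w b c L l
  | and φ ψ, L, l => φ.HoldsBounded w b c L l ∧ ψ.HoldsBounded w b c L l
  | ex φ, L, l =>
    ∃ y < b ^ (L + φ.numStates c), φ.HoldsBounded w b c (L + φ.numStates c) (y :: l)

variable {α : Type*} {w : ℕ → α} {b c : ℕ}

theorem isRecognizable (hb : 0 < b) (hw : HasStateBound b c w) (φ : SeqFormula) :
    IsRecognizable b (φ.numStates c) (φ.Holds w) := by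
  induction φ with
  | le i j k => exact isRecognizable_le i j k
  | same i j k => exact isRecognizable_same hw i j k
  | not φ ih => exact ih.not
  | and φ ψ ih ih' => exact ih.and ih'
  | ex φ ih => exact ih.exists hb

theorem getD_cons_eq (y : ℕ) (l : List ℕ) :
    (fun i => (y :: l).getD i 0) = consVal y fun i => l.getD i 0 := by
  funext i; cases i <;> simp [consVal]

theorem holdsBounded_iff (hb : 2 ≤ b) (hw : HasStateBound b c w) (φ : SeqFormula) :
    ∀ (L : ℕ) (l : List ℕ), (∀ i, l.getD i 0 < b ^ L) →
      (φ.HoldsBounded w b c L l ↔ φ.Holds w fun i => l.getD i 0) := by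
  induction φ with
  | le i j k => exact fun _ _ _ => Iff.rfl
  | same i j k => exact fun _ _ _ => Iff.rfl
  | not φ ih => exact fun L l h => not_congr (ih L l h)
  | and φ ψ ih ih' => exact fun L l h => and_congr (ih L l h) (ih' L l h)
  | ex φ ih =>
    intro L l h
    have hy : ∀ y < b ^ (L + φ.numStates c),
        (φ.HoldsBounded w b c (L + φ.numStates c) (y :: l) ↔
          φ.Holds w (consVal y fun i => l.getD i 0)) := by
      intro y hy
      rw [ih, getD_cons_eq]
      intro i
      rw [show (y :: l).getD i 0 = consVal y (fun i => l.getD i 0) i from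
        congrFun (getD_cons_eq y l) i]
      exact consVal_lt hy
        (fun i => (h i).trans_le (Nat.pow_le_pow_right (by omega) (by omega))) i
    constructor
    · rintro ⟨y, hlt, h'⟩
      exact ⟨y, (hy y hlt).1 h'⟩
    · intro h'
      obtain ⟨y, hlt, hyR⟩ := (isRecognizable (by omega) hw φ).exists_small hb h h'
      exact ⟨y, hlt, (hy y hlt).2 hyR⟩

/-- The formula expressing that a sequence is ultimately uniformly recurrent. The variable `9` is
never bound and stands for `0`. -/
def recurrence : SeqFormula :=
  -- The binders are, from the outside, `N`, `i`, `n`, `K`, `j`, `y`, `t`; universal quantifiers are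
  -- written as `¬ ∃ ¬`.
  ex <| not <| ex <| and (le 1 0 9) <| ex <| not <| ex <| not <| ex <|
    and (le 4 0 9) <| not <| ex <| and (le 1 0 9) <| and (le 0 1 2) <|
      not <| ex <| and (not (le 4 0 9)) <| not (same 5 1 0)

theorem holds_recurrence : recurrence.Holds w (fun _ => 0) ↔ UltimatelyUniformlyRecurrent w := by
  simp only [recurrence, Holds, consVal, UltimatelyUniformlyRecurrent, add_zero, not_exists,
    not_and, not_not, not_le, not_forall, exists_prop]

end SeqFormula

/-! ### Primitive recursive evaluation from the table -/

/-- The base-`b` digits of `i`, most significant digit first. -/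
def codeDigits (b i : ℕ) : List ℕ :=
  ((fun p : List ℕ × ℕ => if p.2 = 0 then p else (p.2 % b :: p.1, p.2 / b))^[i] ([], i)).1

/-- The output letter and the list of successors of the state `q` in a description. -/
def codeRow (a : ℕ × ℕ × ℕ × List (ℕ × List ℕ)) (q : ℕ) : ℕ × List ℕ :=
  a.2.2.2.getD q (0, [])

/-- The successor of the state `p.1` under the digit `p.2` in a description. -/
def codeStep (a : ℕ × ℕ × ℕ × List (ℕ × List ℕ)) (p : ℕ × ℕ) : ℕ :=
  (codeRow a p.1).2.getD p.2 0

/-- The output of the automaton with a given description after reading a word of digits. -/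
def codeOutput (a : ℕ × ℕ × ℕ × List (ℕ × List ℕ)) (x : List ℕ) : ℕ :=
  (codeRow a (x.foldl (fun q d => codeStep a (q, d)) a.2.2.1)).1

/-- The sequence computed by the automaton with a given description. -/
def codeSequence (o : DigitOrder) (a : ℕ × ℕ × ℕ × List (ℕ × List ℕ)) (i : ℕ) : ℕ :=
  match o with
  | .msdFirst => codeOutput a (codeDigits a.1 i)
  | .lsdFirst => codeOutput a (codeDigits a.1 i).reverse

/-- A bound on the number of states of an automaton that reads the most significant digit first
and computes the same sequence as the automaton with a given description. -/
def codeStateBound (o : DigitOrder) (a : ℕ × ℕ × ℕ × List (ℕ × List ℕ)) : ℕ :=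
  match o with
  | .msdFirst => a.2.2.2.length + 1
  | .lsdFirst => a.2.1 ^ a.2.2.2.length + 1

section Primrec

theorem primrec₂_pow : Primrec₂ ((· ^ ·) : ℕ → ℕ → ℕ) :=
  Primrec₂.unpaired'.1 Nat.Primrec.pow

theorem primrec_codeDigits : Primrec₂ codeDigits := by
  refine Primrec.fst.comp (Primrec.nat_iterate Primrec.snd
    (Primrec.pair (Primrec.const []) Primrec.snd) ?_)
  have hp : Primrec fun x : (ℕ × ℕ) × (List ℕ × ℕ) => x.2.2 := Primrec.snd.comp Primrec.snd
  have hb : Primrec fun x : (ℕ × ℕ) × (List ℕ × ℕ) => x.1.1 := Primrec.fst.comp Primrec.fst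
  refine Primrec.ite (Primrec.eq.comp hp (Primrec.const 0)) Primrec.snd
    (Primrec.pair (Primrec.list_cons.comp (Primrec.nat_mod.comp hp hb)
      (Primrec.fst.comp Primrec.snd)) (Primrec.nat_div.comp hp hb))

theorem primrec_codeRow : Primrec₂ codeRow :=
  (Primrec.list_getD _).comp
    ((Primrec.snd.comp (Primrec.snd.comp Primrec.snd)).comp Primrec.fst) Primrec.snd

theorem primrec_codeStep : Primrec₂ codeStep :=
  (Primrec.list_getD 0).comp (Primrec.snd.comp (primrec_codeRow.comp Primrec.fst
    (Primrec.fst.comp Primrec.snd))) (Primrec.snd.comp Primrec.snd)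

theorem primrec_codeOutput : Primrec₂ codeOutput := by
  have hstart : Primrec fun x : (ℕ × ℕ × ℕ × List (ℕ × List ℕ)) × List ℕ => x.1.2.2.1 :=
    (Primrec.fst.comp (Primrec.snd.comp Primrec.snd)).comp Primrec.fst
  have hstep : Primrec₂ fun (x : (ℕ × ℕ × ℕ × List (ℕ × List ℕ)) × List ℕ) (p : ℕ × ℕ) =>
      codeStep x.1 p := primrec_codeStep.comp (Primrec.fst.comp Primrec.fst) Primrec.snd
  exact Primrec.fst.comp (primrec_codeRow.comp Primrec.fst
    (Primrec.list_foldl Primrec.snd hstart hstep))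

theorem primrec_codeSequence (o : DigitOrder) : Primrec₂ (codeSequence o) := by
  have hdigits : Primrec fun x : (ℕ × ℕ × ℕ × List (ℕ × List ℕ)) × ℕ => codeDigits x.1.1 x.2 :=
    primrec_codeDigits.comp (Primrec.fst.comp Primrec.fst) Primrec.snd
  cases o
  · exact primrec_codeOutput.comp Primrec.fst hdigits
  · exact primrec_codeOutput.comp Primrec.fst (Primrec.list_reverse.comp hdigits)

theorem primrec_codeStateBound (o : DigitOrder) : Primrec (codeStateBound o) := by
  have hlen : Primrec fun a : ℕ × ℕ × ℕ × List (ℕ × List ℕ) => a.2.2.2.length :=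
    Primrec.list_length.comp (Primrec.snd.comp (Primrec.snd.comp Primrec.snd))
  cases o
  · exact Primrec.succ.comp hlen
  · exact Primrec.succ.comp (primrec₂_pow.comp (Primrec.fst.comp Primrec.snd) hlen)

theorem SeqFormula.primrec_numStates (φ : SeqFormula) : Primrec fun c => φ.numStates c := by
  induction φ with
  | le => exact Primrec.const 4
  | same => exact primrec₂_pow.comp Primrec.id (Primrec.const 4)
  | not φ ih => exact ih
  | and φ ψ ih ih' => exact Primrec.nat_mul.comp ih ih'
  | ex φ ih => exact primrec₂_pow.comp (Primrec.const 2) ih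

theorem SeqFormula.primrecPred_holdsBounded {A : Type*} [Primcodable A] {w : A → ℕ → ℕ}
    {b c : A → ℕ} (hw : Primrec₂ w) (hb : Primrec b) (hc : Primrec c) (φ : SeqFormula) :
    PrimrecPred fun x : A × ℕ × List ℕ => φ.HoldsBounded (w x.1) (b x.1) (c x.1) x.2.1 x.2.2 := by
  have hget : ∀ i, Primrec fun x : A × ℕ × List ℕ => x.2.2.getD i 0 := fun i =>
    (Primrec.list_getD 0).comp (Primrec.snd.comp Primrec.snd) (Primrec.const i)
  induction φ with
  | le i j k => exact Primrec.nat_le.comp (hget i) (Primrec.nat_add.comp (hget j) (hget k))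
  | same i j k =>
    exact Primrec.eq.comp (hw.comp Primrec.fst (Primrec.nat_add.comp (hget i) (hget k)))
      (hw.comp Primrec.fst (Primrec.nat_add.comp (hget j) (hget k)))
  | not φ ih => exact ih.not
  | and φ ψ ih ih' => exact ih.and ih'
  | ex φ ih =>
    have hL : Primrec fun x : A × ℕ × List ℕ => x.2.1 + φ.numStates (c x.1) :=
      Primrec.nat_add.comp (Primrec.fst.comp Primrec.snd)
        (φ.primrec_numStates.comp (hc.comp Primrec.fst))
    have hrel : PrimrecRel fun (y : ℕ) (x : A × ℕ × List ℕ) =>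
        φ.HoldsBounded (w x.1) (b x.1) (c x.1) (x.2.1 + φ.numStates (c x.1)) (y :: x.2.2) :=
      ih.comp (Primrec.pair (Primrec.fst.comp Primrec.snd) (Primrec.pair (hL.comp Primrec.snd)
        (Primrec.list_cons.comp Primrec.fst
          (Primrec.snd.comp (Primrec.snd.comp Primrec.snd)))))
    refine (hrel.exists_mem_list.comp (Primrec.list_range.comp
      (primrec₂_pow.comp (hb.comp Primrec.fst) hL)) Primrec.id).of_eq fun x => ?_
    simp only [List.mem_range, id, HoldsBounded]

end Primrec

/-! ### Correctness of the evaluation on actual tables -/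

theorem codeDigits_eq {b : ℕ} (hb : 2 ≤ b) (i : ℕ) :
    codeDigits b i = (Nat.digits b i).reverse := by
  -- Each division by `b ≥ 2` decreases a positive number, so `i` iterations exhaust the digits of
  -- `i`; at `0` the iteration is stationary.
  have key : ∀ n m (l : List ℕ), m ≤ n →
      ((fun p : List ℕ × ℕ => if p.2 = 0 then p else (p.2 % b :: p.1, p.2 / b))^[n] (l, m)).1 =
        (Nat.digits b m).reverse ++ l := by
    intro n
    induction n with
    | zero => intro m l hm; simp [Nat.le_zero.1 hm]
    | succ n ih =>
      intro m l hm
      rw [Function.iterate_succ_apply]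
      by_cases h0 : m = 0
      · subst h0
        simpa using ih 0 l (Nat.zero_le _)
      · have := Nat.div_lt_self (Nat.pos_of_ne_zero h0) hb
        rw [if_neg h0, ih _ _ (by dsimp only; omega),
          Nat.digits_def' hb (Nat.pos_of_ne_zero h0)]
        simp
  exact (key i i [] le_rfl).trans (List.append_nil _)

namespace DigitAutomaton

variable (M : DigitAutomaton)

theorem map_val_digits (i : ℕ) : (M.digits i).map Fin.val = Nat.digits M.base i := by
  simp [digits, List.map_pmap]

theorem codeRow_code (q : Fin M.numStates) :
    codeRow M.code q = ((M.out q : ℕ), List.ofFn fun d => (M.step q d : ℕ)) := by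
  simp [codeRow, code, List.getD_eq_getElem?_getD]

theorem codeStep_code (q : Fin M.numStates) (d : Fin M.base) :
    codeStep M.code (q, d) = M.step q d := by
  simp [codeStep, codeRow_code, List.getD_eq_getElem?_getD]

theorem foldl_codeStep_code (x : List (Fin M.base)) (q : Fin M.numStates) :
    (x.map Fin.val).foldl (fun q d => codeStep M.code (q, d)) (q : ℕ) =
      ((x.foldl M.step q : Fin M.numStates) : ℕ) := by
  induction x generalizing q with
  | nil => rfl
  | cons d x ih => rw [List.map_cons, List.foldl_cons, List.foldl_cons, ← ih, codeStep_code]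

theorem codeOutput_code (x : List (Fin M.base)) :
    codeOutput M.code (x.map Fin.val) = M.output x := by
  rw [codeOutput, show M.code.2.2.1 = (M.start : ℕ) from rfl, foldl_codeStep_code, codeRow_code,
    output]

theorem codeSequence_code (o : DigitOrder) (i : ℕ) :
    codeSequence o M.code i = M.sequence o i := by
  have hd : codeDigits M.code.1 i = ((M.digits i).map Fin.val).reverse := by
    rw [map_val_digits]; exact codeDigits_eq M.two_le_base i
  cases o
  · rw [sequence, inputWord, ← codeOutput_code, List.map_reverse, ← hd, codeSequence]
  · rw [sequence, inputWord, ← codeOutput_code, codeSequence, hd, List.reverse_reverse]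

theorem digits_mul_add (i : ℕ) (d : Fin M.base) (h : M.base * i + d ≠ 0) :
    M.digits (M.base * i + d) = d :: M.digits i := by
  apply List.map_injective_iff.2 Fin.val_injective
  rw [map_val_digits, List.map_cons, map_val_digits, add_comm]
  refine Nat.digits_add _ M.two_le_base _ _ d.2 ?_
  by_contra hc
  push Not at hc
  exact h (by simp [hc])

end DigitAutomaton

/-! ### State bounds for both digit orders -/

/-- A deterministic automaton whose transitions are only specified for expansions without leading
zeros still gives a bound on the number of states. -/
theorem HasStateBound.of_ne_zero {α Q : Type} [Fintype Q] {b c : ℕ} {w : ℕ → α} (s : ℕ → Q)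
    (hc : Fintype.card Q ≤ c)
    (hs : ∀ u u' d, d < b → u ≠ 0 → u' ≠ 0 → s u = s u' → s (b * u + d) = s (b * u' + d))
    (hw : ∀ u u', s u = s u' → w u = w u') : HasStateBound b (c + 1) w := by
  -- The extra state `none` belongs to the value `0` and absorbs leading zeros.
  refine ⟨Option Q, inferInstance, fun i => if i = 0 then none else some (s i), ?_, ?_, ?_⟩
  · rw [Fintype.card_option]; omega
  · intro u u' d hd hu
    by_cases h : u = 0 <;> by_cases h' : u' = 0 <;> simp only [h, h', if_true, if_false] at hu ⊢
    · simp at hu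
    · simp at hu
    · have hb : b ≠ 0 := by omega
      simp [h, h', hb, hs u u' d hd h h' (Option.some_injective _ hu)]
  · intro u u' hu
    by_cases h : u = 0 <;> by_cases h' : u' = 0 <;> simp only [h, h', if_true, if_false] at hu ⊢
    · simp at hu
    · simp at hu
    · exact hw _ _ (Option.some_injective _ hu)

namespace DigitAutomaton

/-- For least significant digit first, the state is the map sending each `q` to the output of the
run from `q`. A new low digit is read first, so it precomposes this map with a transition; there are
`numLetters ^ numStates` such maps. -/
theorem hasStateBound (M : DigitAutomaton) (o : DigitOrder) :
    HasStateBound M.base (codeStateBound o M.code) (M.sequence o) := by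
  have hne : ∀ u d, u ≠ 0 → M.base * u + d ≠ 0 := fun u d hu => by
    have := M.two_le_base
    have := Nat.mul_ne_zero (show M.base ≠ 0 by omega) hu
    omega
  cases o
  · refine HasStateBound.of_ne_zero (fun i => (M.digits i).reverse.foldl M.step M.start)
      (by simp [code]) ?_ fun u u' hu => congrArg M.out hu
    intro u u' d hd hu hu' h
    have e := fun v hv => M.digits_mul_add v ⟨d, hd⟩ (hne v d hv)
    simp only at e
    simp only [e u hu, e u' hu', List.reverse_cons, List.foldl_append, List.foldl_cons,
      List.foldl_nil, h]
  · refine HasStateBound.of_ne_zero (fun i q => M.out ((M.digits i).foldl M.step q))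
      (by simp [code]) ?_ fun u u' hu => congrFun hu M.start
    intro u u' d hd hu hu' h
    have e := fun v hv => M.digits_mul_add v ⟨d, hd⟩ (hne v d hv)
    simp only at e
    funext q
    simp only [e u hu, e u' hu', List.foldl_cons]
    exact congrFun h _

end DigitAutomaton

theorem mainTheorem7 (o : DigitOrder) :
    ∃ f : ℕ × ℕ × ℕ × List (ℕ × List ℕ) → Bool, Computable f ∧
      ∀ M : DigitAutomaton,
        (f M.code = true ↔
          (infixSet (M.sequence o)).PartiallyWellOrderedOn (fun u v => u <:+: v)) := by
  obtain ⟨hdec, hf⟩ := (SeqFormula.primrecPred_holdsBounded (primrec_codeSequence o) Primrec.fst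
    (primrec_codeStateBound o) SeqFormula.recurrence).comp
      (Primrec.pair Primrec.id (Primrec.const (0, [])))
  refine ⟨_, hf.to_comp, fun M => ?_⟩
  have hw : HasStateBound M.base (codeStateBound o M.code) (codeSequence o M.code) := by
    obtain ⟨Q, hQ, s, hc, hs, hw⟩ := M.hasStateBound o
    refine ⟨Q, hQ, s, hc, hs, fun u u' h => ?_⟩
    rw [M.codeSequence_code, M.codeSequence_code, hw u u' h]
  rw [decide_eq_true_iff, infixSet_partiallyWellOrderedOn_iff_recurrent]
  -- The empty list gives every variable the value `0 < b ^ 0`, so the initial digit bound is `0`.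
  refine (SeqFormula.holdsBounded_iff M.two_le_base hw _ 0 [] (by simp)).trans ?_
  simp only [List.getD_nil]
  rw [SeqFormula.holds_recurrence]
  simp only [UltimatelyUniformlyRecurrent, M.codeSequence_code, Fin.val_inj]
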